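/- Let $D$ be a finitely generated abelian group and let $S=\bigoplus_{e\in D}S_e$ be a $D$-graded commutative noetherian integral domain. Assume that the grading is effective, i.e. $D$ is generated by $\{e\in D : S_e\neq 0\}$, and that $S$ is factorially $D$-graded, i.e. every nonzero homogeneous nonunit is a product of $D$-prime elements, where a homogeneous nonzero nonunit $p$ is called $D$-prime if $p\mid gh$ with $g,h$ homogeneous implies $p\mid g$ or $p\mid h$. A homogeneous $f\in S$ is called relevant if the degrees of the homogeneous units of $S_f$ form a subgroup of finite index in $D$. Write $S_{(f)}=(S_f)_0$, and for $d\in D$ let $S(d)_{(f)}=(S_f)_d$, an $S_{(f)}$-module. Let $X=\operatorname{Proj}^D(S)$ be the scheme obtained by gluing the affine schemes $D_+(f)=\operatorname{Spec}S_{(f)}$, $f$ relevant, with $D_+(f)\cap D_+(g)=D_+(fg)$, and let $\mathcal O_X(d)$ be the quasi-coherent $\mathcal O_X$-module glued from the sheaves $\widetilde{S(d)_{(f)}}$ on the $D_+(f)$. Then for every $d\in D$ with $S_d\neq 0$ the natural map $$\varphi_{S,d}\colon S_d\to\Gamma(X,\mathcal O_X(d)),$$ sending $s$ to the section whose restriction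 to each $D_+(f)$ is $s/1$, is an isomorphism of $S_0$-modules. Moreover (the case of degree $0$), the natural map $S_0\to\Gamma(X,\mathcal O_X)$ is an isomorphism of rings. -/

import Mathlib

noncomputable section

namespace DGraded

open AlgebraicGeometry CategoryTheory CategoryTheory.Limits TopologicalSpace Opposite

universe u v

section Algebra

variable {D : Type v} {S : Type u} [AddCommGroup D] [DecidableEq D] [CommRing S]
variable (𝒜 : D → AddSubgroup S) [GradedRing 𝒜]

/-- A homogeneous nonzero nonunit `p` is a `D`-prime element if it has the prime property for
products of homogeneous elements. -/
structure IsDPrimeElem (p : S) : Prop where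
  homogeneous : SetLike.IsHomogeneousElem 𝒜 p
  ne_zero : p ≠ 0
  not_unit : ¬ IsUnit p
  dvd_or_dvd : ∀ g h : S, SetLike.IsHomogeneousElem 𝒜 g → SetLike.IsHomogeneousElem 𝒜 h →
    p ∣ g * h → p ∣ g ∨ p ∣ h

/-- Every nonzero homogeneous nonunit is a product of `D`-prime elements. -/
def IsFactoriallyGraded : Prop :=
  ∀ f : S, SetLike.IsHomogeneousElem 𝒜 f → f ≠ 0 → ¬ IsUnit f →
    ∃ s : Multiset S, (∀ p ∈ s, IsDPrimeElem 𝒜 p) ∧ s.prod = f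

/-- The grading group is generated by the support of the grading. -/
def IsEffectivelyGraded : Prop :=
  AddSubgroup.closure {d : D | 𝒜 d ≠ ⊥} = ⊤

/-- The part of degree `d` of the graded ring `S_f`: all fractions `a / b` with `b` a power
of `f`, `a` and `b` homogeneous and `deg a - deg b = d`. -/
def degPart (f : S) (d : D) : AddSubgroup (Localization.Away f) where
  carrier := {z | ∃ e : D, ∃ a ∈ 𝒜 (d + e), ∃ b ∈ 𝒜 e, b ∈ Submonoid.powers f ∧
    z * algebraMap S _ b = algebraMap S _ a}
  zero_mem' := ⟨0, 0, zero_mem _, 1, SetLike.GradedOne.one_mem, one_mem _, by simp⟩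
  add_mem' := by
    rintro z w ⟨e, a, ha, b, hb, hbf, h⟩ ⟨e', a', ha', b', hb', hbf', h'⟩
    refine ⟨e + e', a * b' + a' * b, add_mem ?_ ?_, b * b', SetLike.mul_mem_graded hb hb',
      mul_mem hbf hbf', ?_⟩
    · rw [← add_assoc]; exact SetLike.mul_mem_graded ha hb'
    · rw [add_comm e, ← add_assoc]; exact SetLike.mul_mem_graded ha' hb
    · simp only [map_add, map_mul, ← h, ← h']; ring
  neg_mem' := by
    rintro z ⟨e, a, ha, b, hb, hbf, h⟩
    exact ⟨e, -a, neg_mem ha, b, hb, hbf, by rw [map_neg, ← h]; ring⟩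

variable {𝒜} in
lemma mul_mem_degPart {f : S} {d e : D} {z w : Localization.Away f}
    (hz : z ∈ degPart 𝒜 f d) (hw : w ∈ degPart 𝒜 f e) : z * w ∈ degPart 𝒜 f (d + e) := by
  obtain ⟨i, a, ha, b, hb, hbf, h⟩ := hz
  obtain ⟨j, a', ha', b', hb', hbf', h'⟩ := hw
  refine ⟨i + j, a * a', ?_, b * b', SetLike.mul_mem_graded hb hb', mul_mem hbf hbf', ?_⟩
  · rw [add_add_add_comm]; exact SetLike.mul_mem_graded ha ha'
  · simp only [map_mul, ← h, ← h']; ring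

variable {𝒜} in
lemma algebraMap_mem_degPart (f : S) {d : D} {a : S} (ha : a ∈ 𝒜 d) :
    algebraMap S (Localization.Away f) a ∈ degPart 𝒜 f d :=
  ⟨0, a, by rwa [add_zero], 1, SetLike.GradedOne.one_mem, one_mem _, by simp⟩

variable {𝒜} in
lemma one_mem_degPart (f : S) : (1 : Localization.Away f) ∈ degPart 𝒜 f 0 := by
  simpa using algebraMap_mem_degPart (𝒜 := 𝒜) f SetLike.GradedOne.one_mem

variable {𝒜} in
lemma pow_mem_degPart {f : S} {d : D} {z : Localization.Away f}
    (hz : z ∈ degPart 𝒜 f d) (n : ℕ) : z ^ n ∈ degPart 𝒜 f (n • d) := by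
  induction n with
  | zero => simpa using one_mem_degPart f
  | succ n ih => rw [pow_succ, succ_nsmul]; exact mul_mem_degPart ih hz

/-- The degree zero part `S_(f)` of `S_f`, as a ring. -/
def away₀ (f : S) : Subring (Localization.Away f) where
  __ := degPart 𝒜 f 0
  one_mem' := one_mem_degPart f
  mul_mem' hz hw := by simpa using mul_mem_degPart hz hw

/-- The degree zero part `S(d)_(f) = (S_f)_d` of the localization of the shifted module `S(d)`,
as a module over `S_(f)`. -/
def awayShift (d : D) (f : S) : Submodule (away₀ 𝒜 f) (Localization.Away f) where
  __ := degPart 𝒜 f d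
  smul_mem' r z hz := by
    have := mul_mem_degPart r.2 hz
    rwa [zero_add] at this

/-- The group `D^f` of degrees of homogeneous units of `S_f`. (For homogeneous `f`, the inverse
of a homogeneous unit is automatically homogeneous of the opposite degree, see
`mem_supportGroup_iff`.) -/
def supportGroup (f : S) : AddSubgroup D where
  carrier := {e | ∃ u : (Localization.Away f)ˣ,
    (u : Localization.Away f) ∈ degPart 𝒜 f e ∧
    ((u⁻¹ : (Localization.Away f)ˣ) : Localization.Away f) ∈ degPart 𝒜 f (-e)}
  zero_mem' := ⟨1, one_mem_degPart f, by simpa using one_mem_degPart f⟩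
  add_mem' := by
    rintro e e' ⟨u, hu, hu'⟩ ⟨w, hw, hw'⟩
    refine ⟨u * w, mul_mem_degPart hu hw, ?_⟩
    rw [neg_add, mul_inv]
    exact mul_mem_degPart hu' hw'
  neg_mem' := by
    rintro e ⟨u, hu, hu'⟩
    exact ⟨u⁻¹, hu', by simpa using hu⟩

lemma mem_supportGroup_iff {f : S} (hf : SetLike.IsHomogeneousElem 𝒜 f) (e : D) :
    e ∈ supportGroup 𝒜 f ↔
      ∃ u : (Localization.Away f)ˣ, (u : Localization.Away f) ∈ degPart 𝒜 f e := by
  refine ⟨fun ⟨u, hu, _⟩ ↦ ⟨u, hu⟩, fun ⟨u, hu⟩ ↦ ⟨u, hu, ?_⟩⟩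
  obtain ⟨j, hj⟩ := hf
  obtain ⟨i, a, ha, b, hb, hbf, h⟩ := hu
  obtain ⟨⟨c, ⟨_, m, rfl⟩⟩, hc⟩ := IsLocalization.surj (Submonoid.powers f)
    ((u⁻¹ : (Localization.Away f)ˣ) : Localization.Away f)
  have key : algebraMap S (Localization.Away f) (a * c) = algebraMap S _ (b * f ^ m) := by
    dsimp only at hc
    rw [map_mul, map_mul, ← h, ← hc]
    linear_combination (algebraMap S (Localization.Away f) b *
      algebraMap S (Localization.Away f) (f ^ m)) * u.mul_inv
  obtain ⟨⟨_, k, rfl⟩, hk⟩ := (IsLocalization.eq_iff_exists (Submonoid.powers f) _).mp key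
  dsimp only at hk
  have hfm (m : ℕ) : f ^ m ∈ 𝒜 (m • j) := SetLike.pow_mem_graded m hj
  have h1 : f ^ k * a ∈ 𝒜 (k • j + (e + i)) := SetLike.mul_mem_graded (hfm k) ha
  have h2 : f ^ k * (b * f ^ m) ∈ 𝒜 ((k • j + (e + i)) + (-e + m • j)) := by
    have := SetLike.mul_mem_graded (hfm k) (SetLike.mul_mem_graded hb (hfm m))
    convert this using 1
    abel_nf
  let c' : S := (DirectSum.decompose 𝒜 c (-e + m • j) : S)
  have h3 : f ^ k * a * c' = f ^ k * (b * f ^ m) := by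
    have := DirectSum.coe_decompose_mul_add_of_left_mem 𝒜 (j := -e + m • j) (b := c) h1
    rw [← this, mul_assoc, hk, DirectSum.decompose_of_mem_same 𝒜 h2]
  refine ⟨m • j, c', SetLike.coe_mem _, f ^ m, hfm m, ⟨m, rfl⟩, ?_⟩
  have hu1 : IsUnit (algebraMap S (Localization.Away f) (f ^ k * b)) := by
    obtain ⟨n, rfl⟩ := hbf
    rw [← pow_add, map_pow]
    exact (IsLocalization.Away.algebraMap_isUnit f).pow _
  have h4 := congrArg (algebraMap S (Localization.Away f)) h3
  simp only [map_mul, map_pow, ← h] at h4 hu1 ⊢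
  refine hu1.mul_left_cancel ?_
  linear_combination (-(u⁻¹ : (Localization.Away f)ˣ) : Localization.Away f) * h4 +
    (algebraMap S (Localization.Away f) f ^ k * algebraMap S (Localization.Away f) b *
    algebraMap S (Localization.Away f) c') * u.mul_inv

/-- A homogeneous `f` is relevant if `S_f` is periodic: the degrees of its homogeneous units
form a subgroup of finite index of `D`. -/
structure IsRelevant (f : S) : Prop where
  homogeneous : SetLike.IsHomogeneousElem 𝒜 f
  finiteIndex : (supportGroup 𝒜 f).FiniteIndex


/-- The canonical map `S_f → S_g` for `f ∣ g`. -/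
def awayMap {f g : S} (h : f ∣ g) : Localization.Away f →+* Localization.Away g :=
  IsLocalization.Away.lift f (g := algebraMap S (Localization.Away g))
    (isUnit_of_dvd_unit (map_dvd _ h) (IsLocalization.Away.algebraMap_isUnit g))

@[simp] lemma awayMap_algebraMap {f g : S} (h : f ∣ g) (a : S) :
    awayMap h (algebraMap S _ a) = algebraMap S _ a :=
  IsLocalization.Away.lift_eq f _ a

lemma awayMap_self (f : S) (z : Localization.Away f) : awayMap (dvd_refl f) z = z := by
  have : awayMap (dvd_refl f) = RingHom.id _ :=
    IsLocalization.ringHom_ext (Submonoid.powers f) (RingHom.ext fun a ↦ by simp)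
  rw [this, RingHom.id_apply]

lemma awayMap_awayMap {f g k : S} (h : f ∣ g) (h' : g ∣ k) (z : Localization.Away f) :
    awayMap h' (awayMap h z) = awayMap (h.trans h') z := by
  have : (awayMap h').comp (awayMap h) = awayMap (h.trans h') :=
    IsLocalization.ringHom_ext (Submonoid.powers f) (RingHom.ext fun a ↦ by simp)
  rw [← this, RingHom.comp_apply]

variable {𝒜} in
lemma exists_homogeneous_quotient {f g : S} {i j : D} (hf : f ∈ 𝒜 i) (hg : g ∈ 𝒜 j)
    (h : f ∣ g) : ∃ q ∈ 𝒜 (j - i), g = f * q := by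
  obtain ⟨q, rfl⟩ := h
  refine ⟨DirectSum.decompose 𝒜 q (j - i), SetLike.coe_mem _, ?_⟩
  rw [← DirectSum.coe_decompose_mul_add_of_left_mem 𝒜 hf, add_sub_cancel,
    DirectSum.decompose_of_mem_same 𝒜 hg]

variable {𝒜} in
lemma awayMap_mem_degPart {f g : S} (hf : SetLike.IsHomogeneousElem 𝒜 f)
    (hg : SetLike.IsHomogeneousElem 𝒜 g) (h : f ∣ g) {d : D} {z : Localization.Away f}
    (hz : z ∈ degPart 𝒜 f d) : awayMap h z ∈ degPart 𝒜 g d := by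
  obtain ⟨i, hi⟩ := hf
  obtain ⟨j, hj⟩ := hg
  obtain ⟨q, hq, e⟩ := exists_homogeneous_quotient hi hj h
  obtain ⟨k, a, ha, b, hb, ⟨n, rfl⟩, hz⟩ := hz
  have hqn := SetLike.pow_mem_graded n hq
  refine ⟨k + n • (j - i), a * q ^ n, ?_, f ^ n * q ^ n, SetLike.mul_mem_graded hb hqn,
    ⟨n, by simp only [e, mul_pow]⟩, ?_⟩
  · rw [← add_assoc]; exact SetLike.mul_mem_graded ha hqn
  · have := congrArg (awayMap h) hz
    simp only [map_mul, awayMap_algebraMap] at this ⊢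
    rw [← mul_assoc, this]

lemma supportGroup_mono {f g : S} (hf : SetLike.IsHomogeneousElem 𝒜 f)
    (hg : SetLike.IsHomogeneousElem 𝒜 g) (h : f ∣ g) :
    supportGroup 𝒜 f ≤ supportGroup 𝒜 g := by
  rintro e ⟨u, hu, hu'⟩
  exact ⟨Units.map (awayMap h).toMonoidHom u, awayMap_mem_degPart (𝒜 := 𝒜) hf hg h hu,
    awayMap_mem_degPart (𝒜 := 𝒜) hf hg h hu'⟩

variable {𝒜} in
lemma IsRelevant.mul {f g : S} (hf : IsRelevant 𝒜 f) (hg : IsRelevant 𝒜 g) :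
    IsRelevant 𝒜 (f * g) := by
  have hfg := hf.homogeneous.mul hg.homogeneous
  have := hf.finiteIndex
  exact ⟨hfg, AddSubgroup.finiteIndex_of_le
    (supportGroup_mono 𝒜 hf.homogeneous hfg (dvd_mul_right f g))⟩

/-- The canonical map `S_(f) → S_(g)` for `f ∣ g`. -/
def away₀Map {f g : S} (hf : SetLike.IsHomogeneousElem 𝒜 f)
    (hg : SetLike.IsHomogeneousElem 𝒜 g) (h : f ∣ g) : away₀ 𝒜 f →+* away₀ 𝒜 g :=
  (awayMap h).restrict _ _ fun _ hz ↦ awayMap_mem_degPart hf hg h hz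

/-- If `g = f q` with `q` homogeneous of degree `c`, and `u` is a homogeneous unit of `S_f` of
degree `-(N c)` with `N > 0`, then `S_(g)` is the localization of `S_(f)` at `q ^ N u`. -/
lemma isLocalization_away₀Map {f g q : S} {i c : D} (hf : f ∈ 𝒜 i) (hq : q ∈ 𝒜 c)
    (hg : SetLike.IsHomogeneousElem 𝒜 g)
    (e : g = f * q) {N : ℕ} (hN : 0 < N) {u v : Localization.Away f} (huv : u * v = 1)
    (hu : u ∈ degPart 𝒜 f (-(N • c))) (hv : v ∈ degPart 𝒜 f (N • c))
    (r : away₀ 𝒜 f) (hr : (r : Localization.Away f) = algebraMap S _ q ^ N * u) :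
    letI := (away₀Map 𝒜 ⟨i, hf⟩ hg (Dvd.intro _ e.symm)).toAlgebra
    IsLocalization.Away r (away₀ 𝒜 g) := by
  let := (away₀Map 𝒜 ⟨i, hf⟩ hg (Dvd.intro _ e.symm)).toAlgebra
  have h : f ∣ g := Dvd.intro _ e.symm
  have hmap (z : away₀ 𝒜 f) : ((algebraMap (away₀ 𝒜 f) (away₀ 𝒜 g) z : away₀ 𝒜 g) :
    Localization.Away g) = awayMap h z := rfl
  have hge : g ∈ 𝒜 (i + c) := e ▸ SetLike.mul_mem_graded hf hq
  have hguv : awayMap h u * awayMap h v = 1 := by rw [← map_mul, huv, map_one]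
  have hgu : IsUnit (algebraMap S (Localization.Away g) g) :=
    IsLocalization.Away.algebraMap_isUnit g
  have hmul : algebraMap S (Localization.Away g) g =
      algebraMap S _ f * algebraMap S _ q := by rw [← map_mul, ← e]
  obtain ⟨w, hw⟩ := hgu.exists_right_inv
  have hwdeg : w ∈ degPart 𝒜 g (-(i + c)) :=
    ⟨i + c, 1, by simpa using SetLike.GradedOne.one_mem, g, hge, ⟨1, by simp⟩, by
      rw [mul_comm, hw, map_one]⟩
  refine IsLocalization.Away.mk r ?_ ?_ ?_
  · refine IsUnit.of_mul_eq_one ⟨(algebraMap S _ f * w) ^ N * awayMap h v, ?_⟩ ?_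
    · have h1 := pow_mem_degPart (mul_mem_degPart (algebraMap_mem_degPart g hf) hwdeg) N
      have h2 := mul_mem_degPart h1 (awayMap_mem_degPart ⟨i, hf⟩ hg h hv)
      have h3 : N • (i + -(i + c)) + N • c = 0 := by
        rw [← smul_add]; simp
      rwa [h3] at h2
    · apply Subtype.ext
      simp only [MulMemClass.coe_mul, OneMemClass.coe_one, hmap, hr, map_mul, map_pow,
        awayMap_algebraMap]
      have : algebraMap S (Localization.Away g) q * (algebraMap S _ f * w) = 1 := by
        rw [← hw, hmul]; ring
      calc _ = (algebraMap S (Localization.Away g) q * (algebraMap S _ f * w)) ^ N *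
            (awayMap h u * awayMap h v) := by ring
        _ = 1 := by rw [this, hguv]; simp
  · rintro ⟨z, k, a, ha, b, hb, ⟨n, rfl⟩, hz⟩
    dsimp only at hb hz
    obtain ⟨N, rfl⟩ : ∃ M, N = M + 1 := ⟨N - 1, by omega⟩
    obtain ⟨w₀, hw₀⟩ := (IsLocalization.Away.algebraMap_isUnit (S := Localization.Away f)
      f).exists_right_inv
    have hw₀deg : w₀ ∈ degPart 𝒜 f (-i) :=
      ⟨i, 1, by simpa using SetLike.GradedOne.one_mem, f, hf, ⟨1, by simp⟩, by
        rw [mul_comm, hw₀, map_one]⟩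
    by_cases h0 : g ^ n = 0
    · have : Subsingleton (Localization.Away g) := by
        refine subsingleton_of_zero_eq_one ?_
        have := hgu.pow n
        rw [← map_pow, h0, map_zero] at this
        exact (isUnit_zero_iff.mp this)
      exact ⟨0, 0, Subtype.ext (Subsingleton.elim _ _)⟩
    have hk : k = n • (i + c) :=
      DirectSum.degree_eq_of_mem_mem 𝒜 hb (SetLike.pow_mem_graded n hge) h0
    subst hk
    refine ⟨n, ⟨algebraMap S _ (a * q ^ (n * N)) * u ^ n * w₀ ^ n, ?_⟩, ?_⟩
    · have h1 := mul_mem_degPart (mul_mem_degPart (algebraMap_mem_degPart f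
        (SetLike.mul_mem_graded ha (SetLike.pow_mem_graded (n * N) hq)))
        (pow_mem_degPart hu n)) (pow_mem_degPart hw₀deg n)
      have h3 : (0 + n • (i + c) + (n * N) • c + n • -((N + 1) • c) + n • -i) = 0 := by
        simp only [smul_add, smul_neg, add_smul, mul_smul, one_smul]; abel
      rwa [h3] at h1
    · apply Subtype.ext
      simp only [MulMemClass.coe_mul, SubmonoidClass.coe_pow, hmap, hr, map_mul, map_pow,
        awayMap_algebraMap]
      have h2 : algebraMap S (Localization.Away g) f * awayMap h w₀ = 1 := by
        rw [← awayMap_algebraMap h, ← map_mul, hw₀, map_one]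
      rw [map_pow, hmul] at hz
      calc _ = z * algebraMap S _ q ^ n * algebraMap S _ q ^ (n * N) * awayMap h u ^ n *
              (algebraMap S (Localization.Away g) f * awayMap h w₀) ^ n := by rw [h2]; ring
        _ = _ := by rw [← hz]; ring
  · intro x y hxy
    have hxy' : awayMap h ((x : Localization.Away f) - y) = 0 := by
      rw [map_sub, ← hmap, ← hmap, hxy, sub_self]
    obtain ⟨⟨s, ⟨_, m, rfl⟩⟩, hs⟩ := IsLocalization.surj (Submonoid.powers f)
      ((x : Localization.Away f) - y)
    dsimp only at hs
    have hs0 : algebraMap S (Localization.Away g) s = 0 := by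
      rw [← awayMap_algebraMap h, ← hs, map_mul, hxy', zero_mul]
    obtain ⟨⟨_, k, rfl⟩, hk⟩ :=
      (IsLocalization.map_eq_zero_iff (Submonoid.powers g) _ _).mp hs0
    have hfu := IsLocalization.Away.algebraMap_isUnit (S := Localization.Away f) f
    have h4 : algebraMap S (Localization.Away f) q ^ k * ((x : Localization.Away f) - y) = 0 := by
      refine ((hfu.pow m).mul (hfu.pow k)).mul_left_cancel ?_
      have := congrArg (algebraMap S (Localization.Away f)) hk
      simp only [e, map_mul, map_pow, map_zero, ← hs] at this
      rw [mul_zero, ← this]; ring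
    refine ⟨k, Subtype.ext ?_⟩
    simp only [MulMemClass.coe_mul, SubmonoidClass.coe_pow, hr]
    obtain ⟨N, rfl⟩ : ∃ M, N = M + 1 := ⟨N - 1, by omega⟩
    linear_combination algebraMap S (Localization.Away f) q ^ (k * N) * u ^ k * h4

variable {𝒜} in
lemma IsRelevant.exists_unit {f : S} (hf : IsRelevant 𝒜 f) (c : D) :
    ∃ N : ℕ, 0 < N ∧ ∃ u v : Localization.Away f, u * v = 1 ∧
      u ∈ degPart 𝒜 f (-(N • c)) ∧ v ∈ degPart 𝒜 f (N • c) := by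
  have := hf.finiteIndex
  obtain ⟨N, hN, -, u, hu, hu'⟩ :=
    (supportGroup 𝒜 f).exists_nsmul_mem_of_index_ne_zero AddSubgroup.FiniteIndex.index_ne_zero c
  exact ⟨N, hN, (u⁻¹ : (Localization.Away f)ˣ), u, u.inv_mul, hu', hu⟩

end Algebra

section Tilde

variable {R R' : CommRingCat.{u}} (φ : R ⟶ R') {M : ModuleCat.{u} R} {M' : ModuleCat.{u} R'}

/-- The morphism `M^~ → φ_* M'^~` of sheaves of modules on `Spec R` induced by a ring homomorphism
`φ : R → R'` and a `φ`-semilinear map `M → M'`. -/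
def tildeMap (α : M ⟶ (ModuleCat.restrictScalars φ.hom).obj M') :
    tilde M ⟶ (Scheme.Modules.pushforward (Spec.map φ)).obj (tilde M') :=
  (tilde.adjunction.homEquiv M _).symm
    (α ≫ (ModuleCat.restrictScalars φ.hom).map (tilde.toOpen M' ⊤) ≫
      ((pushforwardCompModulesSpecToSheafIso φ).inv.app (tilde M')).hom.app (op ⊤))

/-- The canonical map `M → Γ(Spec R, M^~)`. -/
def toTilde (M : ModuleCat.{u} R) : M →+ (tilde M).presheaf.obj (op ⊤) :=
  (tilde.toOpen M ⊤).hom.toAddMonoidHom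

lemma toTilde_smul (M : ModuleCat.{u} R) (r : R) (m : M) :
    toTilde M (r • m) = (Scheme.ΓSpecIso R).inv r • toTilde M m := by
  have h1 : toTilde M (r • m) = r • toTilde M m := (tilde.toOpen M ⊤).hom.map_smul r m
  rw [h1, Scheme.Modules.smul_Spec_def]
  congr 1

/-- On global sections, `tildeMap` is the given map `M → M'`. -/
lemma tildeMap_toTilde (α : M ⟶ (ModuleCat.restrictScalars φ.hom).obj M') (m : M) :
    (tildeMap φ α).app ⊤ (toTilde M m) = toTilde M' (α m) :=
  congr($((tilde.adjunction.homEquiv M _).apply_symm_apply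
    (α ≫ (ModuleCat.restrictScalars φ.hom).map (tilde.toOpen M' ⊤) ≫
      ((pushforwardCompModulesSpecToSheafIso φ).inv.app (tilde M')).hom.app (op ⊤))).hom m)

end Tilde

section Scheme

variable {D : Type v} {S : Type u} [AddCommGroup D] [DecidableEq D] [CommRing S]
variable (𝒜 : D → AddSubgroup S) [GradedRing 𝒜]

/-- The relevant elements of `S`, preordered by `f ≤ g` if `g ∣ f` (so that `f ↦ D_+(f)` is
monotone). -/
def Rel : Type u := {f : S // IsRelevant 𝒜 f}

instance : Preorder (Rel 𝒜) where
  le f g := g.1 ∣ f.1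
  le_refl f := dvd_refl f.1
  le_trans _ _ _ h h' := h'.trans h

/-- The map `S_(g) → S_(f)` for `f ≤ g`. -/
def relMap {f g : Rel 𝒜} (h : f ≤ g) : away₀ 𝒜 g.1 →+* away₀ 𝒜 f.1 :=
  away₀Map 𝒜 g.2.homogeneous f.2.homogeneous h

lemma relMap_self (f : Rel 𝒜) : relMap 𝒜 (le_refl f) = RingHom.id _ :=
  RingHom.ext fun z ↦ Subtype.ext (awayMap_self f.1 z)

lemma relMap_comp {f g k : Rel 𝒜} (h : f ≤ g) (h' : g ≤ k) :
    (relMap 𝒜 h).comp (relMap 𝒜 h') = relMap 𝒜 (h.trans h') :=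
  RingHom.ext fun z ↦ Subtype.ext (awayMap_awayMap h' h (z : Localization.Away k.1))

/-- The diagram of the affine schemes `Spec S_(f)`, `f` relevant, with the open immersions
`Spec S_(f) → Spec S_(g)` for `g ∣ f`. -/
def specDiagram : Rel 𝒜 ⥤ Scheme.{u} where
  obj f := Spec (.of (away₀ 𝒜 f.1))
  map h := Spec.map (CommRingCat.ofHom (relMap 𝒜 (leOfHom h)))
  map_id f := by
    rw [← Spec.map_id, relMap_self]; rfl
  map_comp h h' := by
    rw [← Spec.map_comp, ← relMap_comp]; rfl

lemma exists_isLocalization {f g : Rel 𝒜} (h : f ≤ g) :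
    ∃ r : away₀ 𝒜 g.1,
    letI := (relMap 𝒜 h).toAlgebra
    IsLocalization.Away r (away₀ 𝒜 f.1) := by
  obtain ⟨i, hi⟩ := g.2.homogeneous
  obtain ⟨j, hj⟩ := f.2.homogeneous
  obtain ⟨q, hq, e⟩ := exists_homogeneous_quotient hi hj h
  obtain ⟨N, hN, u, v, huv, hu, hv⟩ := g.2.exists_unit (j - i)
  have hr : algebraMap S _ q ^ N * u ∈ degPart 𝒜 g.1 0 := by
    have := mul_mem_degPart (pow_mem_degPart (algebraMap_mem_degPart g.1 hq) N) hu
    rwa [add_neg_cancel] at this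
  exact ⟨⟨_, hr⟩, isLocalization_away₀Map 𝒜 hi hq f.2.homogeneous e hN huv hu hv _ rfl⟩

instance {f g : Rel 𝒜} (h : f ⟶ g) : IsOpenImmersion ((specDiagram 𝒜).map h) := by
  let := (relMap 𝒜 (leOfHom h)).toAlgebra
  obtain ⟨r, hr⟩ := exists_isLocalization 𝒜 (leOfHom h)
  exact IsOpenImmersion.of_isLocalization r

lemma range_comap_relMap {f k : Rel 𝒜} (h : f ≤ k) {q : S} {i c : D} (hk : k.1 ∈ 𝒜 i)
    (hq : q ∈ 𝒜 c) (e : f.1 = k.1 * q) {N : ℕ} (hN : 0 < N) {u v : Localization.Away k.1}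
    (huv : u * v = 1) (hu : u ∈ degPart 𝒜 k.1 (-(N • c))) (hv : v ∈ degPart 𝒜 k.1 (N • c))
    (r : away₀ 𝒜 k.1) (hr : (r : Localization.Away k.1) = algebraMap S _ q ^ N * u) :
    Set.range (PrimeSpectrum.comap (relMap 𝒜 h)) = PrimeSpectrum.basicOpen r := by
  let := (relMap 𝒜 h).toAlgebra
  have : IsLocalization.Away r (away₀ 𝒜 f.1) :=
    isLocalization_away₀Map 𝒜 hk hq f.2.homogeneous e hN huv hu hv r hr
  exact PrimeSpectrum.localization_away_comap_range (away₀ 𝒜 f.1) r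

instance : ((specDiagram 𝒜) ⋙ Scheme.forget).IsLocallyDirected := by
  constructor
  intro f g k hf hg x y hxy
  let m : Rel 𝒜 := ⟨f.1 * g.1, f.2.mul g.2⟩
  have hmf : m ≤ f := dvd_mul_right f.1 g.1
  have hmg : m ≤ g := dvd_mul_left g.1 f.1
  have hmk : m ≤ k := hmf.trans (leOfHom hf)
  obtain ⟨i, hi⟩ := k.2.homogeneous
  obtain ⟨jf, hjf⟩ := f.2.homogeneous
  obtain ⟨jg, hjg⟩ := g.2.homogeneous
  obtain ⟨p, hp, ef⟩ := exists_homogeneous_quotient hi hjf (leOfHom hf)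
  obtain ⟨q, hq, eg⟩ := exists_homogeneous_quotient hi hjg (leOfHom hg)
  obtain ⟨N, hN, u, u', hu, hud, hud'⟩ := k.2.exists_unit (jf - i)
  obtain ⟨M, hM, v, v', hv, hvd, hvd'⟩ := k.2.exists_unit (jg - i)
  obtain ⟨w, hw⟩ := (IsLocalization.Away.algebraMap_isUnit (S := Localization.Away k.1)
    k.1).exists_right_inv
  have hwd : w ∈ degPart 𝒜 k.1 (-i) :=
    ⟨i, 1, by simpa using SetLike.GradedOne.one_mem, k.1, hi, ⟨1, by simp⟩, by
      rw [mul_comm, hw, map_one]⟩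
  have hkd : algebraMap S (Localization.Away k.1) k.1 ∈ degPart 𝒜 k.1 i :=
    algebraMap_mem_degPart k.1 hi
  let rp : away₀ 𝒜 k.1 := ⟨algebraMap S _ p ^ N * u, by
    have := mul_mem_degPart (pow_mem_degPart (algebraMap_mem_degPart k.1 hp) N) hud
    rwa [add_neg_cancel] at this⟩
  let rq : away₀ 𝒜 k.1 := ⟨algebraMap S _ q ^ M * v, by
    have := mul_mem_degPart (pow_mem_degPart (algebraMap_mem_degPart k.1 hq) M) hvd
    rwa [add_neg_cancel] at this⟩
  have Hf := range_comap_relMap 𝒜 (leOfHom hf) hi hp ef hN hu hud hud' rp rfl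
  have Hg := range_comap_relMap 𝒜 (leOfHom hg) hi hq eg hM hv hvd hvd' rq rfl
  have Hm := range_comap_relMap 𝒜 hmk hi (q := p * (k.1 * q))
    (SetLike.mul_mem_graded hp (SetLike.mul_mem_graded hi hq))
    (by simp only [m, ef, eg]; ring) (N := N * M) (Nat.mul_pos hN hM)
    (u := u ^ M * v ^ N * w ^ (N * M))
    (v := u' ^ M * v' ^ N * algebraMap S _ k.1 ^ (N * M))
    (by
      calc _ = (u * u') ^ M * (v * v') ^ N * (algebraMap S _ k.1 * w) ^ (N * M) := by ring
        _ = 1 := by rw [hu, hv, hw]; simp)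
    (by
      convert mul_mem_degPart (mul_mem_degPart (pow_mem_degPart hud M) (pow_mem_degPart hvd N))
        (pow_mem_degPart hwd (N * M)) using 1
      rw [smul_neg, smul_neg, smul_neg, ← mul_smul, ← mul_smul, mul_comm M N, smul_add, smul_add]
      abel_nf)
    (by
      convert mul_mem_degPart (mul_mem_degPart (pow_mem_degPart hud' M) (pow_mem_degPart hvd' N))
        (pow_mem_degPart hkd (N * M)) using 1
      rw [← mul_smul, ← mul_smul, mul_comm M N, smul_add, smul_add]
      abel_nf)
    (rp ^ M * rq ^ N) (by
      simp only [rp, rq, MulMemClass.coe_mul, SubmonoidClass.coe_pow, map_mul]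
      calc _ = algebraMap S _ p ^ (N * M) * (algebraMap S _ q) ^ (N * M) * u ^ M * v ^ N *
            1 ^ (N * M) := by ring
        _ = _ := by rw [← hw]; ring)
  let z₀ : PrimeSpectrum (away₀ 𝒜 k.1) := PrimeSpectrum.comap (relMap 𝒜 (leOfHom hf)) x
  have hz₀ : z₀ = PrimeSpectrum.comap (relMap 𝒜 (leOfHom hg)) y := hxy
  have hzf : z₀ ∈ PrimeSpectrum.basicOpen rp := Hf.le ⟨x, rfl⟩
  have hzg : z₀ ∈ PrimeSpectrum.basicOpen rq := Hg.le ⟨y, hz₀.symm⟩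
  have hzm : z₀ ∈ PrimeSpectrum.basicOpen (rp ^ M * rq ^ N) := by
    rw [PrimeSpectrum.basicOpen_mul, PrimeSpectrum.basicOpen_pow _ _ hM,
      PrimeSpectrum.basicOpen_pow _ _ hN]
    exact ⟨hzf, hzg⟩
  have hzm' : z₀ ∈ Set.range (PrimeSpectrum.comap (relMap 𝒜 hmk)) := Hm.ge hzm
  obtain ⟨z, hz⟩ := hzm'
  refine ⟨m, homOfLE hmf, homOfLE hmg, z, ?_, ?_⟩
  · apply ((specDiagram 𝒜).map hf).isOpenEmbedding.injective
    change ((specDiagram 𝒜).map (homOfLE hmf) ≫ (specDiagram 𝒜).map hf) z = z₀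
    rw [← Functor.map_comp]
    exact hz
  · apply ((specDiagram 𝒜).map hg).isOpenEmbedding.injective
    change ((specDiagram 𝒜).map (homOfLE hmg) ≫ (specDiagram 𝒜).map hg) z =
      PrimeSpectrum.comap (relMap 𝒜 (leOfHom hg)) y
    rw [← Functor.map_comp, ← hz₀]
    exact hz

/-- The scheme `Proj^D(S)`: the gluing of the affine schemes `Spec S_(f)`, `f` relevant, where
`Spec S_(f)` and `Spec S_(g)` are glued along `Spec S_(fg)`. It is the colimit of the diagram of
the `Spec S_(f)`; that diagram consists of open immersions and is locally directed, so by Mathlib's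
gluing construction the colimit is covered by the `Spec S_(f)` as open subschemes. -/
def Proj : Scheme.{u} := colimit (specDiagram 𝒜)

/-- The open immersion `Spec S_(f) → Proj^D(S)`, with image `D_+(f)`. -/
def chart (f : Rel 𝒜) : Spec (.of (away₀ 𝒜 f.1)) ⟶ Proj 𝒜 := colimit.ι (specDiagram 𝒜) f

lemma map_chart {f g : Rel 𝒜} (h : f ≤ g) :
    Spec.map (CommRingCat.ofHom (relMap 𝒜 h)) ≫ chart 𝒜 g = chart 𝒜 f :=
  colimit.w (specDiagram 𝒜) (homOfLE h)

/-- The `S_(f)`-module `S(d)_(f)`. -/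
def shiftModule (d : D) (f : Rel 𝒜) : ModuleCat.{u} (CommRingCat.of (away₀ 𝒜 f.1)) :=
  .of _ (awayShift 𝒜 d f.1)

/-- The map `S(d)_(g) → S(d)_(f)` for `f ≤ g`, semilinear over `S_(g) → S_(f)`. -/
def shiftMap (d : D) {f g : Rel 𝒜} (h : f ≤ g) :
    shiftModule 𝒜 d g ⟶
      (ModuleCat.restrictScalars (CommRingCat.ofHom (relMap 𝒜 h)).hom).obj (shiftModule 𝒜 d f) :=
  ModuleCat.ofHom (Y := (ModuleCat.restrictScalars (CommRingCat.ofHom (relMap 𝒜 h)).hom).obj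
    (shiftModule 𝒜 d f))
  { toFun z := (⟨awayMap h (z : Localization.Away g.1),
      awayMap_mem_degPart g.2.homogeneous f.2.homogeneous h z.2⟩ : awayShift 𝒜 d f.1)
    map_add' _ _ := Subtype.ext (map_add (awayMap h) _ _)
    map_smul' _ _ := Subtype.ext (map_mul (awayMap h) _ _) }

/-- The direct image on `Proj^D(S)` of the quasi-coherent sheaf associated with `S(d)_(f)` on
`Spec S_(f)`. -/
def chartSheaf (d : D) (f : Rel 𝒜) : (Proj 𝒜).Modules :=
  (Scheme.Modules.pushforward (chart 𝒜 f)).obj (tilde (shiftModule 𝒜 d f))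

/-- For `f ≤ g`, the restriction map from `chartSheaf 𝒜 d g` to `chartSheaf 𝒜 d f` given by
`S(d)_(g) → S(d)_(f)`. -/
def chartRes (d : D) {f g : Rel 𝒜} (h : f ≤ g) : chartSheaf 𝒜 d g ⟶ chartSheaf 𝒜 d f :=
  (Scheme.Modules.pushforward (chart 𝒜 g)).map
      (tildeMap (CommRingCat.ofHom (relMap 𝒜 h)) (shiftMap 𝒜 d h)) ≫
    (Scheme.Modules.pushforwardComp (Spec.map (CommRingCat.ofHom (relMap 𝒜 h)))
      (chart 𝒜 g)).hom.app (tilde (shiftModule 𝒜 d f)) ≫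
    (Scheme.Modules.pushforwardCongr (map_chart 𝒜 h)).hom.app (tilde (shiftModule 𝒜 d f))

/-- The sheaves `chartSheaf 𝒜 d f` with their restriction maps: for `f ≤ g`, the two maps to be
equalized are `chartRes` (from the `g`-component) and the identity (of the `f`-component). -/
def gluingIndex (d : D) : MulticospanIndex
    { L := Rel 𝒜, R := {p : Rel 𝒜 × Rel 𝒜 // p.1 ≤ p.2},
      fst p := p.1.2, snd p := p.1.1 } (Proj 𝒜).Modules where
  left f := chartSheaf 𝒜 d f
  right p := chartSheaf 𝒜 d p.1.1
  fst p := chartRes 𝒜 d p.2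
  snd _ := 𝟙 _

/-- The twisted sheaf `O_X(d)` on `X = Proj^D(S)`: the sheaf of modules glued from the sheaves
`S(d)_(f)^~` on `D_+(f) = Spec S_(f)`, `f` relevant. A section over an open `U` is a family of
sections `t_f` of `S(d)_(f)^~` over `U ∩ D_+(f)` such that `t_g` restricts to `t_f` on
`U ∩ D_+(f)` whenever `g ∣ f` (equivalently, `t_f = t_g` on `U ∩ D_+(fg)` for all `f`, `g`). -/
def twist (d : D) : (Proj 𝒜).Modules := multiequalizer (gluingIndex 𝒜 d)

/-- The element `s / 1` of `S(d)_(f)`, for `s ∈ S_d`. -/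
def shiftElem (d : D) (f : Rel 𝒜) : 𝒜 d →+ shiftModule 𝒜 d f where
  toFun s := (⟨algebraMap S _ (s : S), algebraMap_mem_degPart f.1 s.2⟩ : awayShift 𝒜 d f.1)
  map_zero' := Subtype.ext (map_zero (algebraMap S (Localization.Away f.1)))
  map_add' _ _ := Subtype.ext (map_add (algebraMap S (Localization.Away f.1)) _ _)

/-- The global section `s / 1` of `chartSheaf 𝒜 d f`, for `s ∈ S_d`. -/
def chartSection (d : D) (f : Rel 𝒜) : 𝒜 d →+ (chartSheaf 𝒜 d f).presheaf.obj (op ⊤) :=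
  (toTilde (shiftModule 𝒜 d f)).comp (shiftElem 𝒜 d f)

lemma pushforwardCongr_top {X Y : Scheme.{u}} {f g : X ⟶ Y} (hf : f = g) (M : X.Modules)
    (x : M.presheaf.obj (op ⊤)) :
    ((Scheme.Modules.pushforwardCongr hf).hom.app M).app ⊤ x = x := by
  subst hf
  rw [Scheme.Modules.pushforwardCongr_hom_app_app]
  exact congr($(M.presheaf.map_id _) x)

lemma chartRes_chartSection (d : D) {f g : Rel 𝒜} (h : f ≤ g) (s : 𝒜 d) :
    (chartRes 𝒜 d h).app ⊤ (chartSection 𝒜 d g s) = chartSection 𝒜 d f s := by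
  have h1 := tildeMap_toTilde (CommRingCat.ofHom (relMap 𝒜 h)) (shiftMap 𝒜 d h)
    (shiftElem 𝒜 d g s)
  have h2 : shiftMap 𝒜 d h (shiftElem 𝒜 d g s) = shiftElem 𝒜 d f s :=
    Subtype.ext (awayMap_algebraMap h (s : S))
  rw [h2] at h1
  have h3 : (chartRes 𝒜 d h).app ⊤ (chartSection 𝒜 d g s) =
      (tildeMap (CommRingCat.ofHom (relMap 𝒜 h)) (shiftMap 𝒜 d h)).app ⊤
        (toTilde (shiftModule 𝒜 d g) (shiftElem 𝒜 d g s)) :=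
    pushforwardCongr_top (map_chart 𝒜 h) (tilde (shiftModule 𝒜 d f)) _
  exact h3.trans h1

/-- Global sections of sheaves of modules, as a functor to abelian groups. -/
def globalSections (X : Scheme.{u}) : X.Modules ⥤ Ab.{u} :=
  Scheme.Modules.toPresheaf X ⋙ (evaluation _ _).obj (op ⊤)

instance (X : Scheme.{u}) : PreservesLimits (globalSections X) := by
  have : PreservesLimits ((evaluation (Opens X)ᵒᵖ Ab.{u}).obj (op ⊤)) :=
    evaluationPreservesLimits _
  exact comp_preservesLimits _ _

/-- The compatible family of the maps `s ↦ s / 1`. -/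
def sectionCone (d : D) : Cone ((gluingIndex 𝒜 d).multicospan ⋙ globalSections (Proj 𝒜)) where
  pt := AddCommGrpCat.of (𝒜 d)
  π :=
  { app j := match j with
      | .left f => AddCommGrpCat.ofHom (chartSection 𝒜 d f)
      | .right p => AddCommGrpCat.ofHom (chartSection 𝒜 d p.1.1)
    naturality := by
      rintro _ _ (_ | p | p)
      · ext s
        exact congr($(((gluingIndex 𝒜 d).multicospan ⋙ globalSections (Proj 𝒜)).map_id _) _).symm
      · ext s
        exact (chartRes_chartSection 𝒜 d p.2 s).symm
      · ext s
        rfl }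

/-- The map `S_d → Γ(X, O_X(d))` gluing the sections `s / 1`, as a map of abelian groups. -/
def sectionAddHom (d : D) : 𝒜 d →+ (twist 𝒜 d).presheaf.obj (op ⊤) :=
  AddCommGrpCat.Hom.hom ((isLimitOfPreserves (globalSections (Proj 𝒜))
    (limit.isLimit (gluingIndex 𝒜 d).multicospan)).lift (sectionCone 𝒜 d))

/-- The map `S_0 → S_(f)`. -/
def zeroMap (f : Rel 𝒜) : 𝒜 0 →+* away₀ 𝒜 f.1 where
  toFun s := ⟨algebraMap S _ (s : S), algebraMap_mem_degPart f.1 s.2⟩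
  map_one' := Subtype.ext (map_one (algebraMap S (Localization.Away f.1)))
  map_mul' _ _ := Subtype.ext (map_mul (algebraMap S (Localization.Away f.1)) _ _)
  map_zero' := Subtype.ext (map_zero (algebraMap S (Localization.Away f.1)))
  map_add' _ _ := Subtype.ext (map_add (algebraMap S (Localization.Away f.1)) _ _)

/-- The structure morphism `Proj^D(S) → Spec S_0`. -/
def structureMap : Proj 𝒜 ⟶ Spec (.of (𝒜 0)) :=
  colimit.desc (specDiagram 𝒜)
    { pt := Spec (.of (𝒜 0))
      ι :=
      { app f := Spec.map (CommRingCat.ofHom (zeroMap 𝒜 f))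
        naturality f g h := by
          have : (relMap 𝒜 (leOfHom h)).comp (zeroMap 𝒜 g) = zeroMap 𝒜 f :=
            RingHom.ext fun s ↦ Subtype.ext (awayMap_algebraMap (leOfHom h) (s : S))
          refine Eq.trans (Spec.map_comp _ _).symm (Eq.trans ?_ (Category.comp_id _).symm)
          rw [← this]
          rfl } }

/-- The natural ring homomorphism `S_0 → Γ(X, O_X)`, `X = Proj^D(S)`. -/
def zeroSection : 𝒜 0 →+* (Proj 𝒜).presheaf.obj (op ⊤) :=
  ((Scheme.ΓSpecIso (.of (𝒜 0))).inv ≫ (structureMap 𝒜).appTop).hom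

/-- `Γ(X, O_X(d))`, as a module over `S_0` via `S_0 → Γ(X, O_X)`. -/
def twistSections (d : D) : Type u := (twist 𝒜 d).presheaf.obj (op ⊤)

instance (d : D) : AddCommGroup (twistSections 𝒜 d) :=
  inferInstanceAs (AddCommGroup ((twist 𝒜 d).presheaf.obj (op ⊤)))

instance (d : D) : Module ((Proj 𝒜).presheaf.obj (op ⊤)) (twistSections 𝒜 d) :=
  inferInstanceAs (Module ((Proj 𝒜).presheaf.obj (op ⊤)) ((twist 𝒜 d).presheaf.obj (op ⊤)))

instance (d : D) : Module (𝒜 0) (twistSections 𝒜 d) :=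
  Module.compHom _ (zeroSection 𝒜)


/-- The homogeneous part `S_d` as a module over `S_0`. -/
instance (d : D) : Module (𝒜 0) (𝒜 d) where
  smul r s := ⟨(r : S) * s, by simpa using SetLike.mul_mem_graded r.2 s.2⟩
  one_smul s := Subtype.ext (one_mul (s : S))
  mul_smul r r' s := Subtype.ext (mul_assoc (r : S) r' s)
  smul_zero r := Subtype.ext (mul_zero (r : S))
  smul_add r s t := Subtype.ext (mul_add (r : S) s t)
  add_smul r r' s := Subtype.ext (add_mul (r : S) r' s)
  zero_smul s := Subtype.ext (zero_mul (s : S))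

lemma twist_ext (d : D) {x y : twistSections 𝒜 d}
    (h : ∀ f : Rel 𝒜, (Multiequalizer.ι (gluingIndex 𝒜 d) f).app ⊤ x =
      (Multiequalizer.ι (gluingIndex 𝒜 d) f).app ⊤ y) : x = y := by
  refine Concrete.isLimit_ext _ (isLimitOfPreserves (globalSections (Proj 𝒜))
    (limit.isLimit (gluingIndex 𝒜 d).multicospan)) x y ?_
  rintro (f | p)
  · exact h f
  · have := limit.w (gluingIndex 𝒜 d).multicospan (WalkingMulticospan.Hom.snd p)
    have h2 (z : twistSections 𝒜 d) : ((globalSections (Proj 𝒜)).mapCone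
        (limit.cone (gluingIndex 𝒜 d).multicospan)).π.app (.right p) z =
      (𝟙 (chartSheaf 𝒜 d p.1.1) : _ ⟶ _).app ⊤
      ((Multiequalizer.ι (gluingIndex 𝒜 d) p.1.1).app ⊤ z) :=
      congr(($this).app ⊤ z).symm
    rw [h2, h2, h]

/-- The restriction to `D_+(f)` of the section attached to `s` is `s / 1`. -/
lemma sectionAddHom_ι (d : D) (f : Rel 𝒜) (s : 𝒜 d) :
    (Multiequalizer.ι (gluingIndex 𝒜 d) f).app ⊤ (sectionAddHom 𝒜 d s) = chartSection 𝒜 d f s :=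
  congr($((isLimitOfPreserves (globalSections (Proj 𝒜))
    (limit.isLimit (gluingIndex 𝒜 d).multicospan)).fac (sectionCone 𝒜 d) (.left f)) s)

lemma zeroSection_chart (f : Rel 𝒜) (r : 𝒜 0) :
    (chart 𝒜 f).appTop (zeroSection 𝒜 r) =
      (Scheme.ΓSpecIso (.of (away₀ 𝒜 f.1))).inv (zeroMap 𝒜 f r) := by
  have h1 : chart 𝒜 f ≫ structureMap 𝒜 = Spec.map (CommRingCat.ofHom (zeroMap 𝒜 f)) :=
    colimit.ι_desc _ _
  have h2 := Scheme.ΓSpecIso_inv_naturality (CommRingCat.ofHom (zeroMap 𝒜 f))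
  rw [← h1, Scheme.Hom.comp_appTop] at h2
  exact congr($h2 r).symm

lemma chartSection_smul (d : D) (f : Rel 𝒜) (r : 𝒜 0) (s : 𝒜 d) :
    chartSection 𝒜 d f (r • s) = zeroSection 𝒜 r • chartSection 𝒜 d f s := by
  have h1 : shiftElem 𝒜 d f (r • s) = zeroMap 𝒜 f r • shiftElem 𝒜 d f s :=
    Subtype.ext (map_mul (algebraMap S (Localization.Away f.1)) (r : S) (s : S))
  have h2 := toTilde_smul (shiftModule 𝒜 d f) (zeroMap 𝒜 f r) (shiftElem 𝒜 d f s)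
  have h3 : (zeroSection 𝒜 r • chartSection 𝒜 d f s : (chartSheaf 𝒜 d f).presheaf.obj (op ⊤)) =
      (chart 𝒜 f).appTop (zeroSection 𝒜 r) •
        toTilde (shiftModule 𝒜 d f) (shiftElem 𝒜 d f s) := rfl
  rw [zeroSection_chart] at h3
  exact (congrArg (toTilde (shiftModule 𝒜 d f)) h1).trans (h2.trans h3.symm)

/-- The natural map `φ_d : S_d → Γ(X, O_X(d))`, whose value at `s` is the global section glued
from the local sections `s / 1` on the `D_+(f)`, as a homomorphism of `S_0`-modules. -/
def sectionMap (d : D) : 𝒜 d →ₗ[𝒜 0] twistSections 𝒜 d where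
  __ := sectionAddHom 𝒜 d
  map_smul' r s := by
    refine twist_ext 𝒜 d fun f ↦ ?_
    refine (sectionAddHom_ι 𝒜 d f (r • s)).trans ?_
    refine Eq.trans ?_ (Scheme.Modules.Hom.app_smul _ (zeroSection 𝒜 r) (sectionAddHom 𝒜 d s)).symm
    exact (chartSection_smul 𝒜 d f r s).trans
      (congrArg (zeroSection 𝒜 r • ·) (sectionAddHom_ι 𝒜 d f s).symm)

end Scheme

end DGraded

end

noncomputable section

namespace DGraded

universe u v

/-! ### Existence of relevant elements -/

section Algebra

variable {D : Type v} {S : Type u} [AddCommGroup D] [DecidableEq D] [CommRing S]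
variable {𝒜 : D → AddSubgroup S} [GradedRing 𝒜]

/-! On each `D_+(f)` a section of `O_X(d)` is an element of `(S_f)_d`, so a global section is a
family of fractions `z_f` compatible with the maps `S_g → S_f`. Since `S` is a domain, some nonzero
`f₀` is relevant, `S` embeds into `S_{f₀}`, and injectivity follows.

For surjectivity, write `z_{f₀} = a / b` with `b` a power of `f₀`. Comparison with `z_f` in `S_{f₀
f}` shows that `b` divides `a * f ^ n` for some `n`, for every relevant `f`. It remains to deduce `b
∣ a` (`IsFactoriallyGraded.dvd_of_forall_isRelevant`). Factor `b` into `D`-primes and treat them one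
at a time. A prime `p` missing some relevant `f` can be cancelled against `f ^ n`, by primality.

The delicate case is a `p` of degree `i` dividing all relevant elements; this is where `S_d ≠ 0`
enters (`IsDPrimeElem.dvd_of_forall_isRelevant`). Let `H` be generated by the degrees of the
homogeneous elements prime to `p`. Splitting off powers of `p` shows that `i` generates `D / H`. If
`p` did not divide an element of degree `d + i`, then `d + i ∈ H`, while a nonzero element of `S_d`
gives `d - m • i ∈ H` for some `m ≥ 0`. Hence `(m + 1) • i ∈ H`, so `D / H` is finite, and finitely
many homogeneous elements prime to `p` multiply to a relevant element prime to `p`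
(`exists_isRelevant_mem`), a contradiction. -/

lemma mem_supportGroup_of_dvd {f g : S} {e : D} (hf : SetLike.IsHomogeneousElem 𝒜 f)
    (hg : g ∈ 𝒜 e) (h : g ∣ f) : e ∈ supportGroup 𝒜 f := by
  have hu : IsUnit (algebraMap S (Localization.Away f) g) :=
    isUnit_of_dvd_unit (map_dvd _ h) (IsLocalization.Away.algebraMap_isUnit f)
  exact (mem_supportGroup_iff 𝒜 hf e).mpr ⟨hu.unit, algebraMap_mem_degPart f hg⟩

/-- A submonoid whose homogeneous elements have degrees generating a subgroup of finite index
contains a relevant element. -/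
lemma exists_isRelevant_mem [AddGroup.FG D] (M : Submonoid S)
    (h : (AddSubgroup.closure {e : D | ∃ g ∈ 𝒜 e, g ∈ M}).FiniteIndex) :
    ∃ f ∈ M, IsRelevant 𝒜 f := by
  -- Subgroups of the finitely generated group `D` are finitely generated, so finitely many of the
  -- given degrees suffice; one element of `M` is chosen for each, and their product is the relevant
  -- element.
  have : Module.Finite ℤ D := Module.Finite.iff_addGroup_fg.mpr inferInstance
  obtain ⟨T, hT, hspan⟩ := (Submodule.fg_span_iff_fg_span_finset_subset
    {e : D | ∃ g ∈ 𝒜 e, g ∈ M}).mp (IsNoetherian.noetherian (R := ℤ) _)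
  have hclos : AddSubgroup.closure {e : D | ∃ g ∈ 𝒜 e, g ∈ M} = AddSubgroup.closure (T : Set D) := by
    rw [← Submodule.span_int_eq_addSubgroupClosure, ← Submodule.span_int_eq_addSubgroupClosure,
      hspan]
  have hch : ∀ e : D, ∃ g, e ∈ T → g ∈ 𝒜 e ∧ g ∈ M := fun e ↦ by
    by_cases he : e ∈ T
    · obtain ⟨g, hg⟩ := hT he
      exact ⟨g, fun _ ↦ hg⟩
    · exact ⟨0, fun h ↦ (he h).elim⟩
  choose g hg using hch
  have hhom : SetLike.IsHomogeneousElem 𝒜 (∏ e ∈ T, g e) :=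
    prod_mem (S := SetLike.homogeneousSubmonoid 𝒜) fun e he ↦ ⟨e, (hg e he).1⟩
  refine ⟨∏ e ∈ T, g e, prod_mem fun e he ↦ (hg e he).2, hhom, ?_⟩
  rw [hclos] at h
  refine AddSubgroup.finiteIndex_of_le (H := AddSubgroup.closure (T : Set D))
    ((AddSubgroup.closure_le _).mpr fun e he ↦ ?_)
  exact mem_supportGroup_of_dvd hhom (hg e he).1 (Finset.dvd_prod_of_mem g he)

/-- In a domain the nonzero elements form a submonoid, and effectivity says that their degrees
generate `D`. Nonvanishing matters because `0` is itself relevant, with zero localization. -/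
lemma exists_isRelevant_ne_zero [AddGroup.FG D] [IsDomain S] (heff : IsEffectivelyGraded 𝒜) :
    ∃ f : S, f ≠ 0 ∧ IsRelevant 𝒜 f := by
  have h : {d : D | 𝒜 d ≠ ⊥} = {e : D | ∃ g ∈ 𝒜 e, g ∈ nonZeroDivisors S} := by
    ext e
    simp only [Set.mem_ofPred_eq, mem_nonZeroDivisors_iff_ne_zero]
    exact (𝒜 e).ne_bot_iff_exists_ne_zero.trans
      ⟨fun ⟨g, hg⟩ ↦ ⟨g, g.2, fun h ↦ hg (Subtype.ext h)⟩,
        fun ⟨g, hg, h0⟩ ↦ ⟨⟨g, hg⟩, fun h ↦ h0 congr(($h).1)⟩⟩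
  obtain ⟨f, hf, hr⟩ := exists_isRelevant_mem (𝒜 := 𝒜) (nonZeroDivisors S) (by
    rw [← h, heff]
    infer_instance)
  exact ⟨f, nonZeroDivisors.ne_zero hf, hr⟩

/-! ### Divisibility tested on relevant elements -/

/-- The homogeneous elements not divisible by a given `D`-prime element. -/
def IsDPrimeElem.complement {p : S} (hp : IsDPrimeElem 𝒜 p) : Submonoid S where
  carrier := {g | SetLike.IsHomogeneousElem 𝒜 g ∧ ¬ p ∣ g}
  one_mem' := ⟨(SetLike.homogeneousSubmonoid 𝒜).one_mem, fun h ↦ hp.not_unit (isUnit_of_dvd_one h)⟩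
  mul_mem' hg hh := ⟨hg.1.mul hh.1,
    fun h ↦ (hp.dvd_or_dvd _ _ hg.1 hh.1 h).elim hg.2 hh.2⟩

/-- A nonzero homogeneous element is the product of a power of `p` and a homogeneous element
not divisible by `p`. -/
lemma IsDPrimeElem.exists_eq_pow_mul [IsDomain S] [IsNoetherianRing S] {p : S} {i : D}
    (hp : IsDPrimeElem 𝒜 p) (hi : p ∈ 𝒜 i) {g : S} {e : D} (hg : g ∈ 𝒜 e) (h0 : g ≠ 0) :
    ∃ k : ℕ, ∃ g' ∈ 𝒜 (e - k • i), ¬ p ∣ g' ∧ g = p ^ k * g' := by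
  obtain ⟨k, c, hc, h⟩ := WfDvdMonoid.max_power_factor' h0 hp.not_unit
  obtain ⟨q, hq, hgq⟩ := exists_homogeneous_quotient (SetLike.pow_mem_graded k hi) hg
    (Dvd.intro c h.symm)
  -- The cofactor `c` of the maximal power of `p` need not be known to be homogeneous; cancelling `p
  -- ^ k` identifies it with the homogeneous quotient `q`.
  have hqc : q = c := mul_left_cancel₀ (pow_ne_zero k hp.ne_zero) (hgq.symm.trans h)
  exact ⟨k, q, hq, hqc ▸ hc, hgq⟩

/-- If `p` divides every relevant element, then all elements of degree `e` are divisible by `p`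
as soon as `S` has a nonzero element of degree `e - deg p`. -/
lemma IsDPrimeElem.dvd_of_forall_isRelevant [AddGroup.FG D] [IsDomain S] [IsNoetherianRing S]
    (heff : IsEffectivelyGraded 𝒜) {p : S} {i : D} (hp : IsDPrimeElem 𝒜 p) (hi : p ∈ 𝒜 i)
    (hrel : ∀ f, IsRelevant 𝒜 f → p ∣ f) {a : S} {e : D} (ha : a ∈ 𝒜 e)
    (hne : 𝒜 (e - i) ≠ ⊥) : p ∣ a := by
  by_contra hpa
  set H := AddSubgroup.closure {e : D | ∃ g ∈ 𝒜 e, g ∈ hp.complement} with hH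
  have hdeg {g : S} {j : D} (hg : g ∈ 𝒜 j) (h : ¬ p ∣ g) : j ∈ H :=
    AddSubgroup.subset_closure ⟨g, hg, ⟨j, hg⟩, h⟩
  have hpow {j : D} (hj : 𝒜 j ≠ ⊥) : ∃ k : ℕ, j - k • i ∈ H := by
    obtain ⟨g, hg⟩ := (𝒜 j).ne_bot_iff_exists_ne_zero.mp hj
    obtain ⟨k, g', hg', h, -⟩ := hp.exists_eq_pow_mul hi g.2 fun h ↦ hg (Subtype.ext h)
    exact ⟨k, hdeg hg' h⟩
  -- The element `a` puts `e` in `H`, and `S_{e-i} ≠ 0` puts `e - i - m • i` in `H`. The difference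
  -- `(m + 1) • i` is a positive multiple of `i`, even for `m = 0`.
  obtain ⟨m, hm⟩ := hpow hne
  have hm' : (m + 1) • i ∈ H := by
    have := H.sub_mem (hdeg ha hpa) hm
    rwa [show e - (e - i - m • i) = (m + 1) • i by rw [succ_nsmul]; abel] at this
  -- Modulo `H` every degree of a nonzero element is a multiple of `i`, so `m + 1` annihilates `D /
  -- H`, which is thus finitely generated torsion, hence finite.
  have htop : H.comap (nsmulAddMonoidHom (m + 1)) = ⊤ := by
    rw [eq_top_iff, ← heff, AddSubgroup.closure_le]
    intro j hj
    obtain ⟨k, hk⟩ := hpow hj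
    change (m + 1) • j ∈ H
    have := H.add_mem (H.nsmul_mem hk (m + 1)) (H.nsmul_mem hm' k)
    rwa [smul_sub, smul_comm k, sub_add_cancel] at this
  have : Module.Finite ℤ (D ⧸ H) := Module.Finite.iff_addGroup_fg.mpr inferInstance
  have hfin : Finite (D ⧸ H) := AddCommGroup.finite_of_fg_isAddTorsion _ fun x ↦ by
    obtain ⟨j, rfl⟩ := QuotientAddGroup.mk_surjective x
    refine isOfFinAddOrder_iff_nsmul_eq_zero.mpr ⟨m + 1, m.succ_pos, ?_⟩
    rw [← QuotientAddGroup.mk_nsmul, QuotientAddGroup.eq_zero_iff]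
    exact (AddSubgroup.eq_top_iff' _).mp htop j
  obtain ⟨f, hf, hfr⟩ := exists_isRelevant_mem (𝒜 := 𝒜) hp.complement
    (AddSubgroup.finiteIndex_of_finite_quotient)
  exact hf.2 (hrel f hfr)

/-- Induction on the number of prime factors, with `d` varying: removing `p` from the divisor raises
the degree of the quotient by `deg p`. -/
lemma homogeneous_dvd_of_forall_isRelevant [AddGroup.FG D] [IsDomain S] [IsNoetherianRing S]
    (heff : IsEffectivelyGraded 𝒜) (s : Multiset S) (hs : ∀ p ∈ s, IsDPrimeElem 𝒜 p)
    {a : S} {d j : D} (hsj : s.prod ∈ 𝒜 j) (ha : a ∈ 𝒜 (d + j)) (hd : 𝒜 d ≠ ⊥)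
    (h : ∀ f, IsRelevant 𝒜 f → ∃ n : ℕ, s.prod ∣ a * f ^ n) : s.prod ∣ a := by
  induction s using Multiset.induction_on generalizing a d j with
  | empty => simp
  | cons p s ih =>
    have hp := hs p (Multiset.mem_cons_self p s)
    have hs' : ∀ q ∈ s, IsDPrimeElem 𝒜 q := fun q hq ↦ hs q (Multiset.mem_cons_of_mem hq)
    obtain ⟨i, hi⟩ := hp.homogeneous
    obtain ⟨k, hk⟩ : SetLike.IsHomogeneousElem 𝒜 s.prod :=
      multiset_prod_mem (S := SetLike.homogeneousSubmonoid 𝒜) s fun q hq ↦ (hs' q hq).homogeneous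
    have hs0 : s.prod ≠ 0 := Multiset.prod_ne_zero fun h0 ↦ (hs' 0 h0).ne_zero rfl
    rw [Multiset.prod_cons] at hsj h ⊢
    have hj : i + k = j := DirectSum.degree_eq_of_mem_mem 𝒜 (SetLike.mul_mem_graded hi hk) hsj
      (mul_ne_zero hp.ne_zero hs0)
    subst hj
    obtain ⟨c, hc⟩ := (𝒜 d).ne_bot_iff_exists_ne_zero.mp hd
    -- Multiplication by `p` carries a nonzero element of degree `d` to one of degree `d + i`, so
    -- the induction hypothesis applies to `s.prod`.
    have hd' : 𝒜 (d + i) ≠ ⊥ := (𝒜 (d + i)).ne_bot_iff_exists_ne_zero.mpr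
      ⟨⟨c * p, SetLike.mul_mem_graded c.2 hi⟩, fun h0 ↦
        mul_ne_zero (fun h ↦ hc (Subtype.ext h)) hp.ne_zero congr(($h0).1)⟩
    rw [← add_assoc] at ha
    obtain ⟨a', ha', rfl⟩ := exists_homogeneous_quotient hk ha (ih hs' hk ha hd' fun f hf ↦ by
      obtain ⟨n, hn⟩ := h f hf
      exact ⟨n, (Dvd.intro_left p rfl).trans hn⟩)
    rw [add_sub_cancel_right] at ha'
    rw [mul_comm p]
    refine mul_dvd_mul_left _ ?_
    have h' : ∀ f, IsRelevant 𝒜 f → ∃ n : ℕ, p ∣ a' * f ^ n := fun f hf ↦ by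
      obtain ⟨n, hn⟩ := h f hf
      rw [mul_comm p, mul_assoc] at hn
      exact ⟨n, (mul_dvd_mul_iff_left hs0).mp hn⟩
    -- Either the degree argument applies to `a'`, of degree `d + i`, or some relevant `f` is prime
    -- to `p`, and then so is `f ^ n`.
    by_cases hrel : ∀ f, IsRelevant 𝒜 f → p ∣ f
    · exact hp.dvd_of_forall_isRelevant heff hi hrel ha' (by rwa [add_sub_cancel_right])
    · push Not at hrel
      obtain ⟨f, hf, hpf⟩ := hrel
      obtain ⟨n, hn⟩ := h' f hf
      refine (hp.dvd_or_dvd a' (f ^ n) ⟨_, ha'⟩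
        (pow_mem (S := SetLike.homogeneousSubmonoid 𝒜) hf.homogeneous n) hn).resolve_right ?_
      exact (hp.complement.pow_mem ⟨hf.homogeneous, hpf⟩ n).2

/-- A homogeneous `b` divides `a` if it does so in `S_f` for all relevant `f`, provided that `S`
has a nonzero element of degree `deg a - deg b`. -/
lemma IsFactoriallyGraded.dvd_of_forall_isRelevant [AddGroup.FG D] [IsDomain S]
    [IsNoetherianRing S] (heff : IsEffectivelyGraded 𝒜) (hfact : IsFactoriallyGraded 𝒜)
    {a b : S} {d j : D} (hb : b ∈ 𝒜 j) (hb0 : b ≠ 0) (ha : a ∈ 𝒜 (d + j)) (hd : 𝒜 d ≠ ⊥)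
    (h : ∀ f, IsRelevant 𝒜 f → ∃ n : ℕ, b ∣ a * f ^ n) : b ∣ a := by
  by_cases hu : IsUnit b
  · exact hu.dvd
  obtain ⟨s, hs, rfl⟩ := hfact b ⟨j, hb⟩ hb0 hu
  exact homogeneous_dvd_of_forall_isRelevant heff s hs hb ha hd h

/-! ### Compatible families of fractions -/

lemma algebraMap_away_injective [IsDomain S] {f : S} (hf : f ≠ 0) :
    Function.Injective (algebraMap S (Localization.Away f)) :=
  IsLocalization.injective _ (powers_le_nonZeroDivisors_of_noZeroDivisors hf)

lemma subsingleton_away_zero : Subsingleton (Localization.Away (0 : S)) :=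
  subsingleton_of_zero_eq_one (by
    have h := IsLocalization.Away.algebraMap_isUnit (S := Localization.Away (0 : S)) (0 : S)
    rwa [map_zero, isUnit_zero_iff] at h)

lemma awayMap_injective [IsDomain S] {f g : S} (h : f ∣ g) (hg : g ≠ 0) :
    Function.Injective (awayMap h) := by
  rw [injective_iff_map_eq_zero]
  intro z hz
  obtain ⟨⟨a, b⟩, hab⟩ := IsLocalization.surj (Submonoid.powers f) z
  have h1 := congrArg (awayMap h) hab
  simp only [map_mul, hz, zero_mul, awayMap_algebraMap] at h1
  have ha : a = 0 := algebraMap_away_injective hg (by rw [← h1, map_zero])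
  rw [ha, map_zero] at hab
  exact (IsLocalization.map_units (Localization.Away f) b).mul_left_eq_zero.mp hab

/-- Elements of degree `d` of the rings `S_f`, `f` relevant, that are compatible with the maps
`S_g → S_f`, come from an element of `S_d`. -/
lemma IsFactoriallyGraded.exists_algebraMap_eq [AddGroup.FG D] [IsDomain S]
    [IsNoetherianRing S] (heff : IsEffectivelyGraded 𝒜) (hfact : IsFactoriallyGraded 𝒜)
    {d : D} (hd : 𝒜 d ≠ ⊥) (z : ∀ f : Rel 𝒜, Localization.Away f.1)
    (hz : ∀ f, z f ∈ degPart 𝒜 f.1 d)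
    (hcompat : ∀ (f g : Rel 𝒜) (h : f ≤ g), awayMap (show g.1 ∣ f.1 from h) (z g) = z f) :
    ∃ s ∈ 𝒜 d, ∀ f : Rel 𝒜, algebraMap S _ s = z f := by
  obtain ⟨f₀, hf₀, hr₀⟩ := exists_isRelevant_ne_zero heff
  obtain ⟨e, a, ha, b, hb, ⟨n, rfl⟩, hab⟩ := hz ⟨f₀, hr₀⟩
  have hb0 : f₀ ^ n ≠ 0 := pow_ne_zero n hf₀
  dsimp only at hb hab
  -- `D_+(f₀ f)` lies in both `D_+(f₀)` and `D_+(f)`, so `z` at `f₀ * f` is the common restriction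
  -- of the two values.
  have hcross (f : S) (hf : IsRelevant 𝒜 f) {w : Localization.Away (f₀ * f)}
      (hw : w = z ⟨f₀ * f, hr₀.mul hf⟩) : w = awayMap (dvd_mul_right f₀ f) (z ⟨f₀, hr₀⟩) ∧
      w = awayMap (dvd_mul_left f f₀) (z ⟨f, hf⟩) :=
    ⟨hw.trans (hcompat ⟨f₀ * f, hr₀.mul hf⟩ ⟨f₀, hr₀⟩ (dvd_mul_right f₀ f)).symm,
      hw.trans (hcompat ⟨f₀ * f, hr₀.mul hf⟩ ⟨f, hf⟩ (dvd_mul_left f f₀)).symm⟩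
  have hdvd : f₀ ^ n ∣ a := by
    refine hfact.dvd_of_forall_isRelevant heff hb hb0 ha hd fun f hf ↦ ?_
    by_cases hf0 : f = 0
    -- The exponent must be positive so that `f ^ n = 0`.
    · exact ⟨1, by simp [hf0]⟩
    obtain ⟨-, a', -, -, -, ⟨m, rfl⟩, hab'⟩ := hz ⟨f, hf⟩
    dsimp only at hab'
    -- In `S_{f₀ f}` the fractions `a / f₀ ^ n` and `a' / f ^ m` agree; cross-multiplying gives `a *
    -- f ^ m = f₀ ^ n * a'`, which already holds in `S`.
    refine ⟨m, a', algebraMap_away_injective (mul_ne_zero hf₀ hf0) ?_⟩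
    obtain ⟨h1, h2⟩ := hcross f hf rfl
    have h3 := congrArg (awayMap (dvd_mul_right f₀ f)) hab
    have h4 := congrArg (awayMap (dvd_mul_left f f₀)) hab'
    rw [map_mul, ← h1, awayMap_algebraMap, awayMap_algebraMap] at h3
    rw [map_mul, ← h2, awayMap_algebraMap, awayMap_algebraMap] at h4
    rw [map_mul, map_mul, ← h3, ← h4]
    ring
  obtain ⟨s, hs, rfl⟩ := exists_homogeneous_quotient hb ha hdvd
  rw [add_sub_cancel_right] at hs
  have hz₀ : z ⟨f₀, hr₀⟩ = algebraMap S _ s := by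
    have hu : IsUnit (algebraMap S (Localization.Away f₀) (f₀ ^ n)) := by
      rw [map_pow]
      exact (IsLocalization.Away.algebraMap_isUnit f₀).pow n
    refine hu.mul_right_cancel ?_
    rw [hab, map_mul, mul_comm]
  refine ⟨s, hs, fun ⟨f, hf⟩ ↦ ?_⟩
  by_cases hf0 : f = 0
  · subst hf0
    exact subsingleton_away_zero.elim _ _
  · refine awayMap_injective (dvd_mul_left f f₀) (mul_ne_zero hf₀ hf0) ?_
    obtain ⟨h1, h2⟩ := hcross f hf rfl
    rw [← h2, h1, hz₀, awayMap_algebraMap, awayMap_algebraMap]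

end Algebra
end DGraded
end

noncomputable section

namespace DGraded

open AlgebraicGeometry CategoryTheory CategoryTheory.Limits TopologicalSpace Opposite

universe u v

lemma toTilde_bijective {R : CommRingCat.{u}} (M : ModuleCat.{u} R) :
    Function.Bijective (toTilde M) :=
  ConcreteCategory.bijective_of_isIso (tilde.toOpen M ⊤)

/-! ### Global sections of the twisted sheaves -/

section Scheme

variable {D : Type v} {S : Type u} [AddCommGroup D] [DecidableEq D] [CommRing S]
variable (𝒜 : D → AddSubgroup S) [GradedRing 𝒜]

/-- Extends `chartRes_chartSection` from the elements `s / 1` to arbitrary fractions, as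
surjectivity requires. -/
lemma chartRes_toTilde (d : D) {f g : Rel 𝒜} (h : f ≤ g) (m : shiftModule 𝒜 d g) :
    (chartRes 𝒜 d h).app ⊤ (toTilde (shiftModule 𝒜 d g) m) =
      toTilde (shiftModule 𝒜 d f) (shiftMap 𝒜 d h m) := by
  have h1 := tildeMap_toTilde (CommRingCat.ofHom (relMap 𝒜 h)) (shiftMap 𝒜 d h) m
  have h3 : (chartRes 𝒜 d h).app ⊤ (toTilde (shiftModule 𝒜 d g) m) =
      (tildeMap (CommRingCat.ofHom (relMap 𝒜 h)) (shiftMap 𝒜 d h)).app ⊤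
        (toTilde (shiftModule 𝒜 d g) m) :=
    pushforwardCongr_top (map_chart 𝒜 h) (tilde (shiftModule 𝒜 d f)) _
  exact h3.trans h1

/-- The restrictions to the `D_+(f)` of a global section of `O_X(d)` are given by a compatible
family of elements of the `S(d)_(f)`. -/
lemma exists_toTilde_eq (d : D) (x : twistSections 𝒜 d) :
    ∃ z : ∀ f : Rel 𝒜, awayShift 𝒜 d f.1,
      (∀ f, (Multiequalizer.ι (gluingIndex 𝒜 d) f).app ⊤ x = toTilde (shiftModule 𝒜 d f) (z f)) ∧
      ∀ (f g : Rel 𝒜) (h : f ≤ g), awayMap (show g.1 ∣ f.1 from h) (z g).1 = (z f).1 := by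
  have hz (f : Rel 𝒜) := (toTilde_bijective (shiftModule 𝒜 d f)).2
    ((Multiequalizer.ι (gluingIndex 𝒜 d) f).app ⊤ x)
  choose z hz using hz
  refine ⟨z, fun f ↦ (hz f).symm, fun f g h ↦ ?_⟩
  -- One of the two maps being equalized is the identity, so the equalizer condition says exactly
  -- that the `g`-component restricts to the `f`-component.
  have hc : Multiequalizer.ι (gluingIndex 𝒜 d) g ≫ chartRes 𝒜 d h =
      Multiequalizer.ι (gluingIndex 𝒜 d) f :=
    (Multiequalizer.condition (gluingIndex 𝒜 d) ⟨(f, g), h⟩).trans (Category.comp_id _)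
  have h1 : (chartRes 𝒜 d h).app ⊤ ((Multiequalizer.ι (gluingIndex 𝒜 d) g).app ⊤ x) =
      (Multiequalizer.ι (gluingIndex 𝒜 d) f).app ⊤ x := congr(($hc).app ⊤ x)
  have h2 : toTilde (shiftModule 𝒜 d f) (shiftMap 𝒜 d h (z g)) =
      toTilde (shiftModule 𝒜 d f) (z f) := by
    refine (chartRes_toTilde 𝒜 d h (z g)).symm.trans ?_
    exact (congrArg ((chartRes 𝒜 d h).app ⊤) (hz g)).trans (h1.trans (hz f).symm)
  exact congrArg Subtype.val ((toTilde_bijective (shiftModule 𝒜 d f)).1 h2)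

/-! ### Global functions on the charts -/

/-- Global functions on `Proj^D(S)` are determined by their restrictions to the `D_+(f)`. -/
lemma proj_section_ext {x y : (Proj 𝒜).presheaf.obj (op ⊤)}
    (h : ∀ f : Rel 𝒜, (chart 𝒜 f).appTop x = (chart 𝒜 f).appTop y) : x = y :=
  (Scheme.IsLocallyDirected.openCover (specDiagram 𝒜)).ext_elem x y h

/-- The element of `S_(f)` given by the restriction to `D_+(f)` of a global function. -/
def chartValue (f : Rel 𝒜) : (Proj 𝒜).presheaf.obj (op ⊤) →+* away₀ 𝒜 f.1 :=
  ((chart 𝒜 f).appTop ≫ (Scheme.ΓSpecIso (.of (away₀ 𝒜 f.1))).hom).hom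

lemma chartValue_zeroSection (f : Rel 𝒜) (r : 𝒜 0) :
    chartValue 𝒜 f (zeroSection 𝒜 r) = zeroMap 𝒜 f r := by
  refine (congrArg (Scheme.ΓSpecIso (.of (away₀ 𝒜 f.1))).hom (zeroSection_chart 𝒜 f r)).trans ?_
  exact congr($((Scheme.ΓSpecIso (.of (away₀ 𝒜 f.1))).inv_hom_id) (zeroMap 𝒜 f r))

lemma chartValue_ext {x y : (Proj 𝒜).presheaf.obj (op ⊤)}
    (h : ∀ f : Rel 𝒜, chartValue 𝒜 f x = chartValue 𝒜 f y) : x = y :=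
  proj_section_ext 𝒜 fun f ↦
    (ConcreteCategory.bijective_of_isIso (Scheme.ΓSpecIso (.of (away₀ 𝒜 f.1))).hom).1 (h f)

/-- The structure sheaf is not `twist 𝒜 0` by construction, so compatibility is obtained separately,
from naturality of the identification of functions on `Spec S_(f)` with `S_(f)`. -/
lemma relMap_chartValue {f g : Rel 𝒜} (h : f ≤ g) (x : (Proj 𝒜).presheaf.obj (op ⊤)) :
    relMap 𝒜 h (chartValue 𝒜 g x) = chartValue 𝒜 f x := by
  have h1 := Scheme.ΓSpecIso_naturality (CommRingCat.ofHom (relMap 𝒜 h))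
  have h2 : (chart 𝒜 g).appTop ≫ (Scheme.ΓSpecIso (.of (away₀ 𝒜 g.1))).hom ≫
      CommRingCat.ofHom (relMap 𝒜 h) =
      (chart 𝒜 f).appTop ≫ (Scheme.ΓSpecIso (.of (away₀ 𝒜 f.1))).hom := by
    rw [← h1, ← Category.assoc, ← Scheme.Hom.comp_appTop, map_chart]
  exact congr($h2 x)

/-! ### Bijectivity of the natural maps -/

variable {𝒜} [AddGroup.FG D] [IsDomain S]

/-- A single chart with `f ≠ 0` suffices, since `S` embeds into `S_f`. -/
theorem sectionMap_injective (heff : IsEffectivelyGraded 𝒜) (d : D) :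
    Function.Injective (sectionMap 𝒜 d) := by
  obtain ⟨f, hf, hr⟩ := exists_isRelevant_ne_zero heff
  intro s t hst
  have h1 : chartSection 𝒜 d ⟨f, hr⟩ s = chartSection 𝒜 d ⟨f, hr⟩ t := by
    refine (sectionAddHom_ι 𝒜 d ⟨f, hr⟩ s).symm.trans (Eq.trans ?_ (sectionAddHom_ι 𝒜 d ⟨f, hr⟩ t))
    exact congrArg ((Multiequalizer.ι (gluingIndex 𝒜 d) ⟨f, hr⟩).app ⊤) hst
  have h2 := (toTilde_bijective (shiftModule 𝒜 d ⟨f, hr⟩)).1 h1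
  exact Subtype.ext (algebraMap_away_injective hf (congrArg Subtype.val h2))

theorem sectionMap_surjective [IsNoetherianRing S] (heff : IsEffectivelyGraded 𝒜)
    (hfact : IsFactoriallyGraded 𝒜) {d : D} (hd : 𝒜 d ≠ ⊥) :
    Function.Surjective (sectionMap 𝒜 d) := by
  intro x
  obtain ⟨z, hz, hc⟩ := exists_toTilde_eq 𝒜 d x
  obtain ⟨s, hs, h⟩ := hfact.exists_algebraMap_eq heff hd (fun f ↦ (z f).1) (fun f ↦ (z f).2) hc
  refine ⟨⟨s, hs⟩, twist_ext 𝒜 d fun f ↦ ?_⟩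
  refine (sectionAddHom_ι 𝒜 d f ⟨s, hs⟩).trans (Eq.trans ?_ (hz f).symm)
  exact congrArg (toTilde (shiftModule 𝒜 d f)) (Subtype.ext (h f))

theorem zeroSection_injective (heff : IsEffectivelyGraded 𝒜) :
    Function.Injective (zeroSection 𝒜) := by
  obtain ⟨f, hf, hr⟩ := exists_isRelevant_ne_zero heff
  intro s t hst
  have h := (chartValue_zeroSection 𝒜 ⟨f, hr⟩ s).symm.trans
    ((congrArg (chartValue 𝒜 ⟨f, hr⟩) hst).trans (chartValue_zeroSection 𝒜 ⟨f, hr⟩ t))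
  exact Subtype.ext (algebraMap_away_injective hf (congrArg Subtype.val h))

theorem zeroSection_surjective [IsNoetherianRing S] (heff : IsEffectivelyGraded 𝒜)
    (hfact : IsFactoriallyGraded 𝒜) : Function.Surjective (zeroSection 𝒜) := by
  intro x
  -- In degree `0` nonvanishing is automatic, witnessed by `1`.
  have h0 : 𝒜 0 ≠ ⊥ := (𝒜 0).ne_bot_iff_exists_ne_zero.mpr
    ⟨⟨1, SetLike.GradedOne.one_mem⟩, fun h ↦ one_ne_zero congr(($h).1)⟩
  obtain ⟨s, hs, h⟩ := hfact.exists_algebraMap_eq heff h0 (fun f ↦ (chartValue 𝒜 f x).1)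
    (fun f ↦ (chartValue 𝒜 f x).2)
    (fun f g h ↦ congrArg Subtype.val (relMap_chartValue 𝒜 h x))
  refine ⟨⟨s, hs⟩, chartValue_ext 𝒜 fun f ↦ ?_⟩
  exact (chartValue_zeroSection 𝒜 f ⟨s, hs⟩).trans (Subtype.ext (h f))

end Scheme

end DGraded

end

theorem mainTheorem8 {D : Type*} {S : Type*} [AddCommGroup D] [AddGroup.FG D] [DecidableEq D]
    [CommRing S] [IsDomain S] [IsNoetherianRing S]
    (𝒜 : D → AddSubgroup S) [GradedRing 𝒜]
    (heff : DGraded.IsEffectivelyGraded 𝒜) (hfact : DGraded.IsFactoriallyGraded 𝒜)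
    (d : D) (hd : 𝒜 d ≠ ⊥) :
    Function.Bijective
        (DGraded.sectionMap 𝒜 d : 𝒜 d →ₗ[𝒜 0] DGraded.twistSections 𝒜 d) ∧
      Function.Bijective
        (DGraded.zeroSection 𝒜 :
          𝒜 0 →+* (DGraded.Proj 𝒜).presheaf.obj (Opposite.op ⊤)) := by
  exact ⟨⟨DGraded.sectionMap_injective heff d, DGraded.sectionMap_surjective heff hfact hd⟩,
    DGraded.zeroSection_injective heff, DGraded.zeroSection_surjective heff hfact⟩
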